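/- Let $\mathcal H_A,\mathcal H_B$ be complex Hilbert spaces of finite dimensions $d_A,d_B$, and let $\mathcal B=\{\mathcal B_x\}_{x=1}^m$ be a family of orthonormal bases $\mathcal B_x=\{|\psi_{xk}\rangle\}_{k=1}^{d_A}$ of $\mathcal H_A$. Suppose that $\mathcal B$ is irreducible, i.e. that its transition graph is connected; the vertices of this graph are the $md_A$ pairs $(x,k)$, and two different vertices $(x,k),(y,l)$ are adjacent iff $\langle\psi_{xk}|\psi_{yl}\rangle\neq0$. Let $\rho$ be a (pure or mixed) state on $\mathcal H_A\otimes\mathcal H_B$ that can generate the assemblage $\{\{|\psi_{xk}\rangle\langle\psi_{xk}|/d_A\}_k\}_x$ under measurements of Bob, i.e. for each $x$ there is a POVM $\{\Pi_{xk}\}_k$ on $\mathcal H_B$ with $\operatorname{tr}_B[\rho(1_A\otimes\Pi_{xk})]=|\psi_{xk}\rangle\langle\psi_{xk}|/d_A$ for all $k$. Then $d_B\ge d_A$; $\rho$ is a maximally entangled state, i.e. every state on $\mathcal H_A\otimes\mathcal H_B$ can be created from $\rho$ by local operations and classical communication (LOCC); and $\rho$ is a zero-uncertainty state with respect to $\mathcal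 B$, i.e. for each $x$ there is a POVM $\{\Pi_{xk}\}_k$ on $\mathcal H_B$ with $\sum_k\operatorname{tr}[\rho(|\psi_{xk}\rangle\langle\psi_{xk}|\otimes\Pi_{xk})]=1$. -/

import Mathlib

open scoped ComplexOrder Kronecker Matrix

noncomputable section

/-- Operators on the Hilbert space `ℂ^a ⊗ ℂ^b`, as matrices indexed by the product basis. The first
factor is Alice's, the second factor is Bob's. -/
abbrev BipartiteOp (a b : ℕ) : Type :=
  Matrix (Fin a × Fin b) (Fin a × Fin b) ℂ

/-- A (pure or mixed) quantum state: a positive semidefinite matrix of trace one. -/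
def IsState {ι : Type*} [Fintype ι] (ρ : Matrix ι ι ℂ) : Prop :=
  ρ.PosSemidef ∧ ρ.trace = 1

/-- The rank-one operator `|ψ⟩⟨ψ|`. -/
def ketbra {d : ℕ} (ψ : EuclideanSpace ℂ (Fin d)) : Matrix (Fin d) (Fin d) ℂ :=
  Matrix.of fun i j => ψ i * star (ψ j)

/-- The partial trace over Bob's factor. -/
def partialTraceB {a b : ℕ} (X : BipartiteOp a b) : Matrix (Fin a) (Fin a) ℂ :=
  Matrix.of fun i j => ∑ l : Fin b, X (i, l) (j, l)

/-- A positive operator-valued measure on `ℂ^b` with `n` outcomes. -/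
structure IsPOVM {b n : ℕ} (E : Fin n → Matrix (Fin b) (Fin b) ℂ) : Prop where
  posSemidef : ∀ k, (E k).PosSemidef
  sum_eq_one : ∑ k, E k = 1

/-- The transition graph of a family of `m` orthonormal bases of `ℂ^d`: the vertices are the pairs
(basis, basis element), and two different vertices are adjacent iff the corresponding basis vectors
are not orthogonal. -/
def transitionGraph {m d : ℕ}
    (B : Fin m → OrthonormalBasis (Fin d) ℂ (EuclideanSpace ℂ (Fin d))) :
    SimpleGraph (Fin m × Fin d) where
  Adj u v := u ≠ v ∧ inner ℂ (B u.1 u.2) (B v.1 v.2) ≠ 0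
  symm := ⟨fun _ _ h => ⟨h.1.symm, fun h0 => h.2 (inner_eq_zero_symm.mp h0)⟩⟩
  loopless := ⟨fun _ h => h.1 rfl⟩

/-- A family of orthonormal bases is irreducible if its transition graph is connected. -/
def IsIrreducibleBasisSet {m d : ℕ}
    (B : Fin m → OrthonormalBasis (Fin d) ℂ (EuclideanSpace ℂ (Fin d))) : Prop :=
  (transitionGraph B).Connected

/-- The map `X ↦ L X L†`. -/
def sandwich {ι κ : Type*} [Fintype ι] [Fintype κ] (L : Matrix κ ι ℂ) :
    Matrix ι ι ℂ →ₗ[ℂ] Matrix κ κ ℂ where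
  toFun X := L * X * Lᴴ
  map_add' X Y := by rw [Matrix.mul_add, Matrix.add_mul]
  map_smul' c X := by simp

/-- `IsLOCC Λ`: the map `Λ` from operators on `ℂ^a ⊗ ℂ^b` to operators on `ℂ^a' ⊗ ℂ^b'` is
implemented by local operations and classical communication, in finitely many rounds. Either the
protocol stops, or one of the parties performs a local measurement with Kraus operators `K i`
(possibly changing the dimension of the local system), announces the outcome `i`, and the two
parties continue with an LOCC protocol `Λ i` that may depend on `i`. -/
inductive IsLOCC {a' b' : ℕ} :
    {a b : ℕ} → (BipartiteOp a b →ₗ[ℂ] BipartiteOp a' b') → Prop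
  | done : IsLOCC LinearMap.id
  | alice {a b c n : ℕ} (K : Fin n → Matrix (Fin c) (Fin a) ℂ)
      (hK : ∑ i, (K i)ᴴ * K i = 1)
      (Λ : Fin n → (BipartiteOp c b →ₗ[ℂ] BipartiteOp a' b')) (hΛ : ∀ i, IsLOCC (Λ i)) :
      IsLOCC (∑ i, Λ i ∘ₗ sandwich (K i ⊗ₖ (1 : Matrix (Fin b) (Fin b) ℂ)))
  | bob {a b c n : ℕ} (K : Fin n → Matrix (Fin c) (Fin b) ℂ)
      (hK : ∑ i, (K i)ᴴ * K i = 1)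
      (Λ : Fin n → (BipartiteOp a c →ₗ[ℂ] BipartiteOp a' b')) (hΛ : ∀ i, IsLOCC (Λ i)) :
      IsLOCC (∑ i, Λ i ∘ₗ sandwich ((1 : Matrix (Fin a) (Fin a) ℂ) ⊗ₖ K i))

/-- A bipartite state is maximally entangled if every state on the same bipartite space can be
created from it by LOCC. -/
def IsMaximallyEntangled {a b : ℕ} (ρ : BipartiteOp a b) : Prop :=
  IsState ρ ∧ ∀ σ : BipartiteOp a b, IsState σ →
    ∃ Λ : BipartiteOp a b →ₗ[ℂ] BipartiteOp a b, IsLOCC Λ ∧ Λ ρ = σ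

/-- A bipartite state is a zero-uncertainty state for the bases `B` of Alice if, for each basis, Bob
has a measurement whose outcome agrees with Alice's outcome with probability one. -/
def IsZeroUncertaintyState {m a b : ℕ}
    (B : Fin m → OrthonormalBasis (Fin a) ℂ (EuclideanSpace ℂ (Fin a)))
    (ρ : BipartiteOp a b) : Prop :=
  IsState ρ ∧ ∀ x, ∃ E : Fin a → Matrix (Fin b) (Fin b) ℂ,
    IsPOVM E ∧ ∑ k, (ρ * (ketbra (B x k) ⊗ₖ E k)).trace = 1

/-- The bipartite state `ρ` generates the assemblage `σ` on Alice's side under measurements of Bob: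
for each setting `x` there is a POVM `E` of Bob with `σ x k = tr_B [ρ (1 ⊗ E k)]` for all `k`. -/
def GeneratesAssemblage {m n a b : ℕ} (ρ : BipartiteOp a b)
    (σ : Fin m → Fin n → Matrix (Fin a) (Fin a) ℂ) : Prop :=
  ∀ x, ∃ E : Fin n → Matrix (Fin b) (Fin b) ℂ,
    IsPOVM E ∧ ∀ k, σ x k = partialTraceB (ρ * ((1 : Matrix (Fin a) (Fin a) ℂ) ⊗ₖ E k))

end

/-! Write `ρ` as a sum of `vecState (M r)`, with `M r` the coefficient matrices of its scaled
eigenvectors. The assemblage condition says that `∑ r, (M r)ᴴ * E k * M r` is the transpose of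
`|ψ_k⟩⟨ψ_k| / d`. Positivity then makes `E k` kill every `M r *ᵥ star ψ_l` with `l ≠ k`, so Bob
separates the labels perfectly and vectors with different labels are orthogonal, even across
different `r`. Hence the transpose of `(M s)ᴴ * M r` is diagonal in every basis, and connectedness
of the transition graph makes it scalar (`exists_conjTranspose_mul_eq_smul_one`). Orthogonality of
the eigenvectors kills the scalars with `s ≠ r`. So Bob can identify `r` and undo the isometry,
which leaves a pure maximally entangled state to teleport with
(`exists_isLOCC_of_conjTranspose_mul_eq`). A nonzero `M r` is injective, which gives the dimension
bound. -/

open Matrix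

/-! ### Bipartite vectors as coefficient matrices -/

/-- The rank-one operator `|M⟩⟨M|` of the vector of `ℂ^a ⊗ ℂ^b` with coefficient matrix `M`. -/
def vecState {a b : ℕ} (M : Matrix (Fin b) (Fin a) ℂ) : BipartiteOp a b :=
  vecMulVec (vec M) (star (vec M))

lemma vecState_smul {a b : ℕ} (z : ℂ) (M : Matrix (Fin b) (Fin a) ℂ) :
    vecState (z • M) = (z * star z) • vecState M := by
  ext p q
  simp [vecState, vecMulVec_apply, vec]
  ring

lemma vecState_zero {a b : ℕ} : vecState (0 : Matrix (Fin b) (Fin a) ℂ) = 0 := by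
  simp [vecState]

lemma trace_vecState {a b : ℕ} (M : Matrix (Fin b) (Fin a) ℂ) :
    (vecState M).trace = (Mᴴ * M).trace := by
  rw [vecState, trace_vecMulVec, dotProduct_comm, star_vec_dotProduct_vec]

lemma sandwich_kronecker_vecState {a b a' b' : ℕ} (A : Matrix (Fin a') (Fin a) ℂ)
    (K : Matrix (Fin b') (Fin b) ℂ) (M : Matrix (Fin b) (Fin a) ℂ) :
    sandwich (A ⊗ₖ K) (vecState M) = vecState (K * M * Aᵀ) := by
  change A ⊗ₖ K * vecState M * (A ⊗ₖ K)ᴴ = _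
  rw [vecState, mul_vecMulVec, vecMulVec_mul, ← star_mulVec, kronecker_mulVec_vec, vecState]

lemma partialTraceB_vecState_mul {a b : ℕ} (M : Matrix (Fin b) (Fin a) ℂ)
    (E : Matrix (Fin b) (Fin b) ℂ) :
    partialTraceB (vecState M * ((1 : Matrix (Fin a) (Fin a) ℂ) ⊗ₖ E)) = (Mᴴ * E * M)ᵀ := by
  ext i j
  simp only [partialTraceB, of_apply, mul_apply, vecState, vecMulVec_apply, vec, Pi.star_apply,
    Fintype.sum_prod_type, kroneckerMap_apply, one_apply, ite_mul, one_mul, zero_mul, mul_ite,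
    mul_zero, transpose_apply, conjTranspose_apply]
  refine Finset.sum_congr rfl fun l _ => ?_
  rw [Finset.sum_comm, Finset.sum_mul]
  refine Finset.sum_congr rfl fun l' _ => ?_
  simp
  ring

/-- The spectral decomposition, with eigenvectors written as coefficient matrices. -/
lemma exists_orthogonal_vecState_decomposition {a b : ℕ} {ρ : BipartiteOp a b}
    (hρ : ρ.PosSemidef) :
    ∃ M : Fin a × Fin b → Matrix (Fin b) (Fin a) ℂ,
      ρ = ∑ r, vecState (M r) ∧ ∀ s r, s ≠ r → ((M s)ᴴ * M r).trace = 0 := by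
  set U : Matrix (Fin a × Fin b) (Fin a × Fin b) ℂ :=
    (hρ.1.eigenvectorUnitary : Matrix (Fin a × Fin b) (Fin a × Fin b) ℂ) with hU
  have hUU : Uᴴ * U = 1 := Unitary.coe_star_mul_self hρ.1.eigenvectorUnitary
  refine ⟨fun r => of fun l i => (√(hρ.1.eigenvalues r) : ℂ) * U (i, l) r, ?_, ?_⟩
  · ext p q
    conv_lhs => rw [hρ.1.spectral_theorem]
    rw [Unitary.conjStarAlgAut_apply]
    rw [← hU, mul_apply]
    simp only [Matrix.sum_apply, vecState, vecMulVec_apply, vec, of_apply, Pi.star_apply,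
      mul_diagonal]
    refine Finset.sum_congr rfl fun r _ => ?_
    have h : (hρ.1.eigenvalues r : ℂ) = √(hρ.1.eigenvalues r) * √(hρ.1.eigenvalues r) := by
      rw [← Complex.ofReal_mul, Real.mul_self_sqrt (hρ.eigenvalues_nonneg r)]
    change U p r * (hρ.1.eigenvalues r : ℂ) * _ = _
    rw [h]
    simp [star_apply]
    ring
  · intro s r hsr
    have h := congr_fun (congr_fun hUU s) r
    rw [one_apply_ne hsr, mul_apply] at h
    rw [← star_vec_dotProduct_vec]
    simp only [dotProduct, vec, of_apply, Pi.star_apply, star_mul']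
    calc _ = ∑ p, star (√(hρ.1.eigenvalues s) : ℂ) * √(hρ.1.eigenvalues r) * (Uᴴ s p * U p r) :=
          Finset.sum_congr rfl fun p _ => by rw [conjTranspose_apply]; ring
      _ = 0 := by rw [← Finset.mul_sum, h, mul_zero]

/-! ### Rigidity from steering an irreducible family -/

/-- The expectation of the sum at `v` is a sum of nonnegative terms `⟨M r v, E k (M r v)⟩`; each
vanishes, and a positive operator annihilates a vector of zero expectation. -/
lemma IsPOVM.mulVec_eq_zero_of_sum_eq {d b n : ℕ} {ι : Type*} [Fintype ι]
    {E : Fin n → Matrix (Fin b) (Fin b) ℂ} (hE : IsPOVM E) (M : ι → Matrix (Fin b) (Fin d) ℂ)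
    {k : Fin n} {v : Fin d → ℂ} (h : (∑ r, (M r)ᴴ * E k * M r) *ᵥ v = 0) (r : ι) :
    E k *ᵥ (M r *ᵥ v) = 0 := by
  have hterm (r) : star v ⬝ᵥ ((M r)ᴴ * E k * M r) *ᵥ v
      = star (M r *ᵥ v) ⬝ᵥ E k *ᵥ (M r *ᵥ v) := by
    rw [Matrix.mul_assoc, ← mulVec_mulVec, dotProduct_mulVec, ← star_mulVec, mulVec_mulVec]
  have hsum : ∑ r, star (M r *ᵥ v) ⬝ᵥ E k *ᵥ (M r *ᵥ v) = 0 := by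
    simp_rw [← hterm]
    rw [← dotProduct_sum, ← sum_mulVec, h, dotProduct_zero]
  rw [Finset.sum_eq_zero_iff_of_nonneg
    fun r _ => (hE.posSemidef k).dotProduct_mulVec_nonneg _] at hsum
  exact ((hE.posSemidef k).dotProduct_mulVec_zero_iff _).1 (hsum r (Finset.mem_univ r))

/-- If a measurement distinguishes the families `w s l` and `w r l` perfectly by the label `l`,
then vectors with different labels are orthogonal. -/
lemma IsPOVM.dotProduct_eq_zero {b n : ℕ} {ι : Type*} {E : Fin n → Matrix (Fin b) (Fin b) ℂ}
    (hE : IsPOVM E) {w : ι → Fin n → Fin b → ℂ} (h : ∀ r k l, k ≠ l → E k *ᵥ w r l = 0)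
    (s r : ι) {k l : Fin n} (hkl : k ≠ l) : star (w s k) ⬝ᵥ w r l = 0 := by
  have hfix : E l *ᵥ w r l = w r l := by
    have h1 := congr_arg (· *ᵥ w r l) hE.sum_eq_one
    simp only [sum_mulVec, one_mulVec] at h1
    rwa [Finset.sum_eq_single l (fun k _ hk => h r k l hk) (by simp)] at h1
  rw [← hfix, dotProduct_mulVec]
  have : star (w s k) ᵥ* E l = star (E l *ᵥ w s k) := by
    rw [star_mulVec, (hE.posSemidef l).1]
  rw [this, h s l k hkl.symm, star_zero, zero_dotProduct]

/-- An operator that is diagonal in every basis of an irreducible family is scalar. -/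
lemma IsIrreducibleBasisSet.exists_eq_smul_one {m d : ℕ}
    {B : Fin m → OrthonormalBasis (Fin d) ℂ (EuclideanSpace ℂ (Fin d))}
    (hB : IsIrreducibleBasisSet B) (T : EuclideanSpace ℂ (Fin d) →ₗ[ℂ] EuclideanSpace ℂ (Fin d))
    (hT : ∀ x k l, k ≠ l → inner ℂ (B x k) (T (B x l)) = 0) :
    ∃ c : ℂ, T = c • LinearMap.id := by
  let c : Fin m × Fin d → ℂ := fun u => inner ℂ (B u.1 u.2) (T (B u.1 u.2))
  have h1 (u : Fin m × Fin d) : T (B u.1 u.2) = c u • B u.1 u.2 := by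
    rw [← (B u.1).sum_repr' (T (B u.1 u.2)), Finset.sum_eq_single u.2]
    · intro k _ hk
      rw [hT _ _ _ hk, zero_smul]
    · simp
  have h2 (u : Fin m × Fin d) (v) : inner ℂ (B u.1 u.2) (T v) = c u * inner ℂ (B u.1 u.2) v := by
    conv_lhs => rw [← (B u.1).sum_repr' v]
    rw [map_sum, inner_sum, Finset.sum_eq_single u.2]
    · rw [map_smul, inner_smul_right, mul_comm]
    · intro k _ hk
      rw [map_smul, inner_smul_right, hT _ _ _ hk.symm, mul_zero]
    · simp
  -- Evaluating `⟨u, T v⟩` from either side gives eigenvalue times overlap, and the overlap is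
  -- nonzero on an edge.
  have hadj (u v) (h : (transitionGraph B).Adj u v) : c u = c v := by
    have := h2 u (B v.1 v.2)
    rw [h1, inner_smul_right] at this
    exact (mul_right_cancel₀ h.2 this).symm
  have hconst (u v) : c u = c v := by
    obtain ⟨p⟩ := hB.preconnected u v
    induction p with
    | nil => rfl
    | cons h _ ih => exact (hadj _ _ h).trans ih
  obtain ⟨u⟩ := hB.nonempty
  refine ⟨c u, (B u.1).toBasis.ext fun k => ?_⟩
  have := h1 (u.1, k)
  rw [hconst _ u] at this
  simpa using this

/-- The coefficient matrices of a state that steers an irreducible family of bases are multiples of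
isometries with mutually orthogonal ranges. -/
lemma exists_conjTranspose_mul_eq_smul_one {m d b : ℕ} {ι : Type*} [Fintype ι]
    {B : Fin m → OrthonormalBasis (Fin d) ℂ (EuclideanSpace ℂ (Fin d))}
    (hB : IsIrreducibleBasisSet B) (M : ι → Matrix (Fin b) (Fin d) ℂ)
    (hgen : GeneratesAssemblage (∑ r, vecState (M r))
      (fun x k => (1 / (d : ℂ)) • ketbra (B x k))) (s r : ι) :
    ∃ c : ℂ, (M s)ᴴ * M r = c • 1 := by
  -- The steered vectors are the conjugates of the basis vectors; the transpose turns this into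
  -- diagonality in the bases themselves.
  obtain ⟨c, hc⟩ := hB.exists_eq_smul_one (toEuclideanLin ((M s)ᴴ * M r)ᵀ) fun x k l hkl => by
    obtain ⟨E, hE, hEk⟩ := hgen x
    have hzero (r k l) (hkl : k ≠ l) : E k *ᵥ (M r *ᵥ star (B x l).ofLp) = 0 := by
      refine hE.mulVec_eq_zero_of_sum_eq M ?_ r
      have h := congr_arg transpose (hEk k)
      have hpt : partialTraceB ((∑ r, vecState (M r)) * ((1 : Matrix (Fin d) (Fin d) ℂ) ⊗ₖ E k))
          = ∑ r, ((M r)ᴴ * E k * M r)ᵀ := by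
        simp_rw [← partialTraceB_vecState_mul, Finset.sum_mul]
        ext i j
        simp only [partialTraceB, of_apply, Matrix.sum_apply]
        rw [Finset.sum_comm]
      rw [hpt, transpose_sum] at h
      simp only [transpose_transpose] at h
      rw [← h]
      have ho := (B x).inner_eq_zero hkl.symm
      rw [EuclideanSpace.inner_eq_star_dotProduct] at ho
      have hk : ketbra (B x k) = vecMulVec (B x k).ofLp (star (B x k).ofLp) := rfl
      rw [transpose_smul, smul_mulVec, hk, transpose_vecMulVec, vecMulVec_mulVec, ho]
      simp
    have h := hE.dotProduct_eq_zero hzero s r hkl.symm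
    rw [EuclideanSpace.inner_eq_star_dotProduct]
    rw [star_mulVec, ← dotProduct_mulVec, mulVec_mulVec, star_star, dotProduct_mulVec,
      ← mulVec_transpose] at h
    exact h
  refine ⟨c, ?_⟩
  have : ((M s)ᴴ * M r)ᵀ = c • 1 := by
    apply toEuclideanLin.injective
    rw [hc, map_smul]
    simp
  rw [← transpose_transpose ((M s)ᴴ * M r), this]
  simp

/-! ### Weyl twirling and teleportation -/

/-- The Weyl operators: a finite family of unitaries averaging every operator to a scalar. -/
lemma exists_unitary_twirl_zmod (N : ℕ) [NeZero N] :
    ∃ W : ZMod N × ZMod N → Matrix (ZMod N) (ZMod N) ℂ, (∀ g, W g * (W g)ᴴ = 1) ∧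
      ∀ X : Matrix (ZMod N) (ZMod N) ℂ, ∑ g, (W g)ᴴ * X * W g = (N * X.trace) • 1 := by
  let e : AddChar (ZMod N) ℂ := ZMod.stdAddChar
  have he (x) : star (e x) = e (-x) := by
    rw [AddChar.map_neg_eq_conj]; rfl
  let W : ZMod N × ZMod N → Matrix (ZMod N) (ZMod N) ℂ := fun g =>
    of fun i j => if i = j + g.1 then e (g.2 * j) else 0
  refine ⟨W, fun g => ?_, fun X => ?_⟩
  · ext i j
    simp only [W, mul_apply, conjTranspose_apply, of_apply, apply_ite star, star_zero, mul_ite,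
      mul_zero, ite_mul, zero_mul]
    rw [Finset.sum_eq_single (i - g.1)]
    · by_cases h : j = i
      · subst h
        simp [he, ← AddChar.map_add_eq_mul]
      · simp [h, one_apply_ne (Ne.symm h)]
    · intro k _ hk
      have : i ≠ k + g.1 := by
        rintro rfl
        simp at hk
      simp [this]
    · simp
  · ext i j
    have hterm (g : ZMod N × ZMod N) :
        ((W g)ᴴ * X * W g) i j = X (i + g.1) (j + g.1) * e (g.2 * (j - i)) := by
      simp only [W, mul_apply, conjTranspose_apply, of_apply, apply_ite star, star_zero, mul_ite,
        mul_zero, ite_mul, zero_mul, Finset.sum_ite_eq', Finset.mem_univ, if_true, he]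
      rw [mul_sub, sub_eq_add_neg, AddChar.map_add_eq_mul]
      ring
    -- Summing over phases kills the off-diagonal entries; summing over shifts turns the diagonal
    -- ones into the trace.
    have hchar : ∑ b, e (b * (j - i)) = if j = i then (N : ℂ) else 0 := by
      rw [AddChar.sum_mulShift _ (ZMod.isPrimitive_stdAddChar N), ZMod.card]
      simp [sub_eq_zero]
    rw [Matrix.sum_apply, Finset.sum_congr rfl fun g _ => hterm g, Fintype.sum_prod_type]
    dsimp only
    simp_rw [← Finset.mul_sum, hchar, ← Finset.sum_mul]
    by_cases h : j = i
    · subst h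
      have hshift : ∑ x, X (j + x) (j + x) = X.trace :=
        Equiv.sum_comp (Equiv.addLeft j) fun x => X x x
      rw [hshift, if_pos rfl, Matrix.smul_apply, one_apply_eq, smul_eq_mul, mul_one, mul_comm]
    · simp [h, one_apply_ne (Ne.symm h)]

lemma exists_unitary_twirl (d : ℕ) : ∃ W : Fin d × Fin d → Matrix (Fin d) (Fin d) ℂ,
    (∀ g, W g * (W g)ᴴ = 1) ∧
      ∀ X : Matrix (Fin d) (Fin d) ℂ, ∑ g, (W g)ᴴ * X * W g = (d * X.trace) • 1 := by
  rcases d with _ | n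
  · exact ⟨fun _ => 1, by simp, fun X => by ext i; exact i.elim0⟩
  -- `ZMod (n + 1)` unfolds to `Fin (n + 1)`.
  · exact exists_unitary_twirl_zmod (n + 1)

lemma IsLOCC.kronecker_unitary {a b : ℕ} {U : Matrix (Fin a) (Fin a) ℂ} (hU : Uᴴ * U = 1) :
    IsLOCC (sandwich (U ⊗ₖ (1 : Matrix (Fin b) (Fin b) ℂ))) := by
  simpa using IsLOCC.alice (b := b) (fun _ : Fin 1 => U) (by simpa using hU)
    (fun _ => LinearMap.id) fun _ => IsLOCC.done

/-- Bob measures and Alice applies a unitary that depends on the outcome. -/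
lemma isLOCC_sum_sandwich_kronecker {a b c : ℕ} {ι : Type*} [Fintype ι]
    (K : ι → Matrix (Fin c) (Fin b) ℂ) (hK : ∑ i, (K i)ᴴ * K i = 1)
    (U : ι → Matrix (Fin a) (Fin a) ℂ) (hU : ∀ i, (U i)ᴴ * U i = 1) :
    IsLOCC (∑ i, sandwich (U i ⊗ₖ K i)) := by
  let e := (Fintype.equivFin ι).symm
  have h := IsLOCC.bob (a := a) (fun i => K (e i))
    (by rw [← hK]; exact Equiv.sum_comp e fun i => (K i)ᴴ * K i)
    (fun i => sandwich (U (e i) ⊗ₖ (1 : Matrix (Fin c) (Fin c) ℂ)))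
    fun i => IsLOCC.kronecker_unitary (hU (e i))
  convert h using 1
  rw [← Equiv.sum_comp e]
  refine Finset.sum_congr rfl fun i _ => LinearMap.ext fun X => ?_
  have hmul : U (e i) ⊗ₖ K (e i) = (U (e i) ⊗ₖ (1 : Matrix (Fin c) (Fin c) ℂ)) *
      ((1 : Matrix (Fin a) (Fin a) ℂ) ⊗ₖ K (e i)) := by
    rw [← mul_kronecker_mul, Matrix.mul_one, Matrix.one_mul]
  simp only [LinearMap.comp_apply, sandwich, LinearMap.coe_mk, AddHom.coe_mk, hmul,
    conjTranspose_mul, Matrix.mul_assoc]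

/-- A state whose coefficient matrices are multiples of isometries with mutually orthogonal ranges
can be converted by LOCC into every state: Bob recovers a pure maximally entangled state and uses
it to teleport Alice's part of a locally prepared state. -/
lemma exists_isLOCC_of_conjTranspose_mul_eq {d b : ℕ} {ι : Type*} [Fintype ι] [DecidableEq ι]
    (M : ι → Matrix (Fin b) (Fin d) ℂ) (c : ι → ℝ) (hc : ∀ r, 0 ≤ c r)
    (hM : ∀ s r, (M s)ᴴ * M r = if s = r then (c r : ℂ) • 1 else 0) (hsum : d * ∑ r, c r = 1)
    {σ : BipartiteOp d b} (hσ : IsState σ) :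
    ∃ Λ : BipartiteOp d b →ₗ[ℂ] BipartiteOp d b, IsLOCC Λ ∧ Λ (∑ r, vecState (M r)) = σ := by
  obtain ⟨S, hS, -⟩ := exists_orthogonal_vecState_decomposition hσ.1
  obtain ⟨W, hW, htwirl⟩ := exists_unitary_twirl d
  have hd : (d : ℝ) ≠ 0 := fun h => by simp [h] at hsum
  have hdC : (d : ℂ) ≠ 0 := by exact_mod_cast hd
  have hW' (g) : (W g)ᴴ * W g = 1 := mul_eq_one_comm.1 (hW g)
  have hM0 (r) (h : c r = 0) : M r = 0 := by
    have := hM r r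
    rw [if_pos rfl, h, Complex.ofReal_zero, zero_smul] at this
    exact conjTranspose_mul_self_eq_zero.1 this
  -- The normalised isometries; if `c r = 0`, the inverse is zero by convention and `V r = 0`.
  let V : ι → Matrix (Fin b) (Fin d) ℂ := fun r => (((√(c r))⁻¹ : ℝ) : ℂ) • M r
  have hVH (s) : (V s)ᴴ = (((√(c s))⁻¹ : ℝ) : ℂ) • (M s)ᴴ := by
    rw [conjTranspose_smul]; simp
  have hVM (s r) : (V s)ᴴ * M r = if s = r then ((√(c r) : ℝ) : ℂ) • 1 else 0 := by
    rw [hVH, smul_mul, hM]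
    split_ifs with h
    · subst h
      rw [smul_smul, ← Complex.ofReal_mul]
      congr 2
      rcases eq_or_ne (√(c s)) 0 with h0 | h0
      · simp [h0]
      · field_simp
        exact (Real.sq_sqrt (hc s)).symm
    · simp
  have hVsM (r) : ((√(c r) : ℝ) : ℂ) • V r = M r := by
    rw [smul_smul, ← Complex.ofReal_mul]
    rcases eq_or_ne (c r) 0 with h0 | h0
    · simp [hM0 r h0]
    · rw [mul_inv_cancel₀ ((Real.sqrt_ne_zero (hc r)).2 h0)]; simp
  let P : Matrix (Fin b) (Fin b) ℂ := ∑ s, V s * (V s)ᴴ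
  have hPH : Pᴴ = P := by
    simp [P, conjTranspose_sum, conjTranspose_mul]
  have hPM (r) : P * M r = M r := by
    simp only [P, Matrix.sum_mul, Matrix.mul_assoc, hVM]
    rw [Finset.sum_eq_single r (by intro s _ h; simp [h]) (by simp)]
    rw [if_pos rfl, Matrix.mul_smul, Matrix.mul_one, hVsM]
  have hPP : P * P = P := by
    have hPV (r) : P * V r = V r := by
      simp only [V, Matrix.mul_smul, hPM]
    conv_lhs => enter [2]; simp only [P]
    rw [Matrix.mul_sum]
    simp only [← Matrix.mul_assoc, hPV, P]
  -- Bob undoes the isometry `V s` and teleports with outcome `g`, using the component `S j` of `σ`.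
  -- By the twirl, the factor `1 / √d` makes these Kraus operators sum to the range projection `P`;
  -- `none` completes them and never occurs on the given state.
  let K : Option (ι × (Fin d × Fin d) × (Fin d × Fin b)) → Matrix (Fin b) (Fin b) ℂ
    | none => 1 - P
    | some (s, g, j) => (((√d)⁻¹ : ℝ) : ℂ) • (S j * W g * (V s)ᴴ)
  -- A local operator of Alice multiplies the coefficient matrix on the right by its transpose, so
  -- this choice cancels `W g`.
  let A : Option (ι × (Fin d × Fin d) × (Fin d × Fin b)) → Matrix (Fin d) (Fin d) ℂ
    | none => 1
    | some (_, g, _) => ((W g)ᴴ)ᵀ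
  have hsq : ((((√d)⁻¹ : ℝ) : ℂ)) * (((√d)⁻¹ : ℝ) : ℂ) = (d : ℂ)⁻¹ := by
    rw [← Complex.ofReal_mul, ← mul_inv, Real.mul_self_sqrt (Nat.cast_nonneg d)]
    simp
  have hStr : (∑ j, (S j)ᴴ * S j).trace = 1 := by
    rw [trace_sum, ← hσ.2, hS, trace_sum]
    simp only [trace_vecState]
  have hK : ∑ i, (K i)ᴴ * K i = 1 := by
    have hterm (s g j) : (K (some (s, g, j)))ᴴ * K (some (s, g, j))
        = (d : ℂ)⁻¹ • (V s * ((W g)ᴴ * ((S j)ᴴ * S j) * W g) * (V s)ᴴ) := by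
      simp only [K, conjTranspose_smul, smul_mul, Matrix.mul_smul, smul_smul, conjTranspose_mul,
        conjTranspose_conjTranspose, Matrix.mul_assoc]
      rw [← hsq]; simp
    have hs (s) : ∑ g, ∑ j, (K (some (s, g, j)))ᴴ * K (some (s, g, j)) = V s * (V s)ᴴ := by
      simp only [hterm, ← Finset.smul_sum, ← Matrix.sum_mul, ← Matrix.mul_sum]
      rw [htwirl, hStr]
      simp [hdC]
    rw [Fintype.sum_option]
    simp only [Fintype.sum_prod_type (α₁ := ι), Fintype.sum_prod_type (α₁ := Fin d × Fin d), hs]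
    change (1 - P)ᴴ * (1 - P) + P = 1
    rw [conjTranspose_sub, hPH, conjTranspose_one, Matrix.sub_mul, Matrix.mul_sub, Matrix.mul_sub, hPP]
    simp
  refine ⟨∑ i, sandwich (A i ⊗ₖ K i), isLOCC_sum_sandwich_kronecker K hK A ?_, ?_⟩
  · rintro (_ | ⟨s, g, j⟩)
    · simp [A]
    · change (((W g)ᴴ)ᵀ)ᴴ * ((W g)ᴴ)ᵀ = 1
      have : (((W g)ᴴ)ᵀ)ᴴ = (W g)ᵀ := by ext; simp
      rw [this, ← transpose_mul, hW', transpose_one]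
  · have hout (s g j r) : sandwich (A (some (s, g, j)) ⊗ₖ K (some (s, g, j))) (vecState (M r))
        = if s = r then ((d : ℂ)⁻¹ * c r) • vecState (S j) else 0 := by
      rw [sandwich_kronecker_vecState]
      change vecState (((((√d)⁻¹ : ℝ) : ℂ) • (S j * W g * (V s)ᴴ)) * M r * ((W g)ᴴ)ᵀᵀ) = _
      rw [smul_mul, smul_mul, Matrix.mul_assoc _ _ (M r), hVM, transpose_transpose]
      split_ifs with h
      · rw [Matrix.mul_smul, smul_mul, Matrix.mul_one, Matrix.mul_assoc, hW, Matrix.mul_one,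
          smul_smul, vecState_smul]
        congr 1
        rw [← hsq]
        have : (c r : ℂ) = √(c r) * √(c r) := by
          rw [← Complex.ofReal_mul, Real.mul_self_sqrt (hc r)]
        rw [this]
        simp
        ring
      · simp [vecState_zero]
    have hnone (r) : sandwich (A none ⊗ₖ K none) (vecState (M r)) = 0 := by
      rw [sandwich_kronecker_vecState]
      change vecState ((1 - P) * M r * _) = 0
      rw [Matrix.sub_mul, hPM]
      simp [vecState_zero]
    have hr (r) : (∑ i, sandwich (A i ⊗ₖ K i)) (vecState (M r)) = ((d : ℂ) * c r) • σ := by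
      rw [LinearMap.sum_apply, Fintype.sum_option, hnone, zero_add]
      simp only [Fintype.sum_prod_type (α₁ := ι), Fintype.sum_prod_type (α₁ := Fin d × Fin d), hout]
      rw [Finset.sum_eq_single r (by intro s _ h; simp [h]) (by simp)]
      simp only [if_true, ← Finset.smul_sum, ← hS, Finset.sum_const, Finset.card_univ,
        Fintype.card_prod, Fintype.card_fin]
      -- The `d ^ 2` outcomes `g` each contribute `c r / d`.
      rw [← Nat.cast_smul_eq_nsmul ℂ, smul_smul]
      congr 1
      push_cast
      field_simp
    rw [map_sum, Finset.sum_congr rfl fun r _ => hr r, ← Finset.sum_smul, ← Finset.mul_sum]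
    have : (d : ℂ) * ∑ r, (c r : ℂ) = 1 := by exact_mod_cast hsum
    rw [this, one_smul]

/-! ### Zero uncertainty and conclusion -/

lemma trace_mul_kronecker {a b : ℕ} (ρ : BipartiteOp a b) (X : Matrix (Fin a) (Fin a) ℂ)
    (E : Matrix (Fin b) (Fin b) ℂ) : (ρ * (X ⊗ₖ E)).trace =
      (partialTraceB (ρ * ((1 : Matrix (Fin a) (Fin a) ℂ) ⊗ₖ E)) * X).trace := by
  simp only [trace, diag_apply, mul_apply, partialTraceB, of_apply, Fintype.sum_prod_type,
    kroneckerMap_apply, one_apply, ite_mul, one_mul, zero_mul, mul_ite, mul_zero]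
  refine Finset.sum_congr rfl fun i _ => ?_
  rw [Finset.sum_comm]
  refine Finset.sum_congr rfl fun j _ => ?_
  rw [Finset.sum_mul]
  refine Finset.sum_congr rfl fun l _ => ?_
  rw [Finset.sum_comm, Finset.sum_mul]
  refine Finset.sum_congr rfl fun l' _ => ?_
  simp
  ring

lemma trace_ketbra_mul_self {d : ℕ} {ψ : EuclideanSpace ℂ (Fin d)} (h : ‖ψ‖ = 1) :
    (ketbra ψ * ketbra ψ).trace = 1 := by
  have h1 : ψ.ofLp ⬝ᵥ star ψ.ofLp = 1 := by
    rw [← EuclideanSpace.inner_eq_star_dotProduct, inner_self_eq_norm_sq_to_K, h]; simp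
  have hk : ketbra ψ = vecMulVec ψ.ofLp (star ψ.ofLp) := rfl
  rw [hk, vecMulVec_mul_vecMulVec, dotProduct_comm, h1]
  simp [h1]

/-- The steering POVM itself works: each of the `a` outcomes agrees with probability `1 / a`. -/
lemma GeneratesAssemblage.isZeroUncertaintyState {m a b : ℕ} (ha : a ≠ 0)
    {B : Fin m → OrthonormalBasis (Fin a) ℂ (EuclideanSpace ℂ (Fin a))} {ρ : BipartiteOp a b}
    (hρ : IsState ρ)
    (hgen : GeneratesAssemblage ρ (fun x k => (1 / (a : ℂ)) • ketbra (B x k))) :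
    IsZeroUncertaintyState B ρ := by
  refine ⟨hρ, fun x => ?_⟩
  obtain ⟨E, hE, hEk⟩ := hgen x
  refine ⟨E, hE, ?_⟩
  have hk (k) : (ρ * (ketbra (B x k) ⊗ₖ E k)).trace = (a : ℂ)⁻¹ := by
    rw [trace_mul_kronecker, ← hEk, smul_mul, trace_smul, trace_ketbra_mul_self ((B x).norm_eq_one k)]
    simp
  simp [hk, ha]

theorem theorem4 (m dA dB : ℕ)
    (B : Fin m → OrthonormalBasis (Fin dA) ℂ (EuclideanSpace ℂ (Fin dA)))
    (hB : IsIrreducibleBasisSet B)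
    (ρ : BipartiteOp dA dB) (hρ : IsState ρ)
    (hgen : GeneratesAssemblage ρ (fun x k => (1 / (dA : ℂ)) • ketbra (B x k))) :
    dA ≤ dB ∧ IsMaximallyEntangled ρ ∧ IsZeroUncertaintyState B ρ := by
  have hd : dA ≠ 0 := by
    obtain ⟨u⟩ := hB.nonempty
    exact (Fin.pos u.2).ne'
  have : NeZero dA := ⟨hd⟩
  obtain ⟨M, rfl, horth⟩ := exists_orthogonal_vecState_decomposition hρ.1
  choose z hz using exists_conjTranspose_mul_eq_smul_one hB M hgen
  have hz0 (r) : 0 ≤ z r r := by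
    have := (posSemidef_conjTranspose_mul_self (M r)).diag_nonneg (i := 0)
    rw [hz] at this
    simpa using this
  have hMz (s r) : (M s)ᴴ * M r = if s = r then ((z r r).re : ℂ) • 1 else 0 := by
    split_ifs with h
    · subst h
      rw [hz, ← Complex.eq_re_of_ofReal_le (r := 0) (by simpa using hz0 s)]
    · have ht := horth s r h
      -- The trace of a scalar matrix is `dA` times the scalar, so orthogonal eigenvectors force the
      -- scalar to vanish.
      rw [hz, trace_smul] at ht
      have : z s r = 0 := by simpa [hd] using ht
      rw [hz, this, zero_smul]
  have hsum : (dA : ℝ) * ∑ r, (z r r).re = 1 := by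
    have h := hρ.2
    simp only [trace_sum, trace_vecState, hMz, if_true, trace_smul, trace_one, Fintype.card_fin,
      smul_eq_mul, ← Finset.sum_mul] at h
    rw [mul_comm]
    exact_mod_cast h
  refine ⟨?_, ⟨hρ, fun σ hσ => exists_isLOCC_of_conjTranspose_mul_eq M _
    (fun r => (Complex.nonneg_iff.1 (hz0 r)).1) hMz hsum hσ⟩, hgen.isZeroUncertaintyState hd hρ⟩
  obtain ⟨r, -, hr⟩ : ∃ r ∈ Finset.univ, (z r r).re ≠ 0 := by
    refine Finset.exists_ne_zero_of_sum_ne_zero fun h => ?_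
    rw [h] at hsum
    simp at hsum
  have hinj : Function.Injective (M r).mulVec := fun v w h => by
    have h2 := congr_arg ((M r)ᴴ *ᵥ ·) h
    simp only [mulVec_mulVec, hMz, if_true, smul_mulVec, one_mulVec] at h2
    exact smul_right_injective _ (Complex.ofReal_ne_zero.2 hr) h2
  simpa using LinearMap.finrank_le_finrank_of_injective (f := (M r).mulVecLin) hinj
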